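/- Let $S$ be a finite set of simple steps, i.e. of vectors $(1,u)$ with $u\in\mathbb{Z}$. A walk of length $n\ge 0$ built from $S$ is a sequence $(A_0,\dots,A_n)$ of points of $\mathbb{Z}^2$ with $A_0=(0,0)$ and $A_k-A_{k-1}\in S$ for $1\le k\le n$; its final altitude is the second coordinate of $A_n$. A meander is a walk all of whose points have non-negative second coordinate. Let $w_{n,k}$ be the number of walks of length $n$ and final altitude $k$, let $m_n$ be the number of meanders of length $n$, and put \[ W(x,y)=\sum_{n\ge 0,\;k\in\mathbb{Z}} w_{n,k}\,x^n y^k\in\mathbb{Z}[y,y^{-1}][[x]],\qquad M(x)=\sum_{n\ge 0} m_n x^n,\qquad \Gamma(y)=\sum_{(1,u)\in S}y^u . \] Define \[ A(x)=[y^0]\,\frac{y}{1-y}\,W(x,y)\in\mathbb{Q}[[x]], \] where $y/(1-y)=\sum_{j\ge 1}y^j$ is expanded in powers of $y$, so that the product is taken in $\mathbb{Q}((y))[[x]]$ and $[y^0]$ is applied to each coefficient of $x^n$. Then $A(0)=0$, and in $\mathbb{Q}[[x]]$ \[ M(x)=\frac{\exp\left(-\int\frac{A(x)}{x}\,\mathrm{d}x\right)}{1-x\,\Gamma(1)},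 \] where $\int$ denotes the formal primitive with zero constant term. -/

import Mathlib

noncomputable section

namespace LatticeWalk

/-- A step set, given by the finite set `S` of the integers `u` such that the simple step `(1, u)`
is allowed. `walks S n` is the set of the walks `(A₀, …, Aₙ)` in `ℤ²` of length `n` built from
`S`: they start at the origin and every increment is an allowed step. -/
def walks (S : Finset ℤ) (n : ℕ) : Set (Fin (n + 1) → ℤ × ℤ) :=
  {A | A 0 = (0, 0) ∧ ∀ k : Fin n, ∃ u ∈ S, A k.succ - A k.castSucc = (1, u)}

/-- The second coordinate of the endpoint. -/
def finalAltitude {n : ℕ} (A : Fin (n + 1) → ℤ × ℤ) : ℤ := (A (Fin.last n)).2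

/-- Meanders: walks that stay in the (closed) upper half plane. -/
def meanders (S : Finset ℤ) (n : ℕ) : Set (Fin (n + 1) → ℤ × ℤ) :=
  {A | A ∈ walks S n ∧ ∀ k, 0 ≤ (A k).2}

/-- `w_{n,k}`: the number of walks of length `n` and final altitude `k`. -/
def walkCount (S : Finset ℤ) (n : ℕ) (k : ℤ) : ℕ :=
  {A | A ∈ walks S n ∧ finalAltitude A = k}.ncard

theorem walks_finite (S : Finset ℤ) (n : ℕ) : (walks S n).Finite := by
  have hfin : (↑(Fintype.piFinset (fun _ : Fin n => S)) : Set (Fin n → ℤ)).Finite :=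
    Finset.finite_toSet _
  refine Set.Finite.of_injOn (f := fun A k => (A k.succ - A k.castSucc).2) ?_ ?_ hfin
  · intro A hA
    simp only [Finset.mem_coe, Fintype.mem_piFinset]
    intro k
    obtain ⟨u, hu, h⟩ := hA.2 k
    rw [h]
    exact hu
  · intro A hA B hB hAB
    funext k
    induction k using Fin.induction with
    | zero => rw [hA.1, hB.1]
    | succ k ih =>
      obtain ⟨u, -, hu⟩ := hA.2 k
      obtain ⟨v, -, hv⟩ := hB.2 k
      have h := congrFun hAB k
      simp only [hu, hv] at h
      rw [← sub_add_cancel (A k.succ) (A k.castSucc), ← sub_add_cancel (B k.succ) (B k.castSucc),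
        hu, hv, h, ih]

theorem walkCount_support_finite (S : Finset ℤ) (n : ℕ) :
    (Function.support fun k : ℤ => (walkCount S n k : ℤ)).Finite := by
  refine ((walks_finite S n).image finalAltitude).subset ?_
  intro k hk
  have hk' : walkCount S n k ≠ 0 := by simpa using hk
  obtain ⟨A, hA⟩ := Set.nonempty_of_ncard_ne_zero hk'
  exact ⟨A, hA.1, hA.2⟩

/-- The full generating series `W(x, y) = ∑ w_{n,k} xⁿ yᵏ` in `ℤ[y, y⁻¹]⟦x⟧`. -/
def W (S : Finset ℤ) : PowerSeries (LaurentPolynomial ℤ) :=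
  PowerSeries.mk fun n =>
    AddMonoidAlgebra.ofCoeff (Finsupp.ofSupportFinite _ (walkCount_support_finite S n))

/-- The generating series of meanders, counted by length. -/
def M (S : Finset ℤ) : PowerSeries ℤ :=
  PowerSeries.mk fun n => ((meanders S n).ncard : ℤ)

/-- The characteristic polynomial `Γ(y) = ∑_{(1,u) ∈ S} yᵘ`, a Laurent polynomial. -/
def Gam (S : Finset ℤ) : LaurentPolynomial ℤ := ∑ u ∈ S, LaurentPolynomial.T u

/-- The number `Γ(1)`. -/
def GamOne (S : Finset ℤ) : ℤ := LaurentPolynomial.eval₂ (RingHom.id ℤ) 1 (Gam S)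

/-- The variable `y` of the field `ℚ((y))` of formal Laurent series. -/
def yVar : LaurentSeries ℚ := HahnSeries.single 1 1

theorem yVar_ne_zero : yVar ≠ 0 := HahnSeries.single_ne_zero one_ne_zero

/-- The inclusion `ℤ[y, y⁻¹] → ℚ((y))`, which sends `y` to `y`. -/
def toLaurentSeries : LaurentPolynomial ℤ →+* LaurentSeries ℚ :=
  LaurentPolynomial.eval₂ (Int.castRingHom (LaurentSeries ℚ)) (Units.mk0 yVar yVar_ne_zero)

/-- The series `y / (1 - y) · W(x, y)` in `ℚ((y))⟦x⟧`; the quotient `y / (1 - y)` is taken in the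
field `ℚ((y))`, that is, expanded in powers of `y`. -/
def yOverOneSubYMulW (S : Finset ℤ) : PowerSeries (LaurentSeries ℚ) :=
  PowerSeries.C (yVar / (1 - yVar)) * PowerSeries.map toLaurentSeries (W S)

/-- `A(x) = [y⁰] y / (1 - y) · W(x, y)`. -/
def A (S : Finset ℤ) : PowerSeries ℚ :=
  PowerSeries.mk fun n => (PowerSeries.coeff n (yOverOneSubYMulW S)).coeff 0

/-- `F / x` for a power series `F` with zero constant term. -/
def divX (F : PowerSeries ℚ) : PowerSeries ℚ :=
  PowerSeries.mk fun n => PowerSeries.coeff (n + 1) F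

/-- The formal primitive `∫ F dx` with zero constant term. -/
def integral (F : PowerSeries ℚ) : PowerSeries ℚ :=
  PowerSeries.X * PowerSeries.mk fun n => PowerSeries.coeff n F / ((n : ℚ) + 1)

/-- The exponential `exp(F)` of a power series `F` with zero constant term. -/
def expOf (F : PowerSeries ℚ) : PowerSeries ℚ :=
  PowerSeries.subst F (PowerSeries.exp ℚ)

end LatticeWalk

end

/-!
Let `M(x, y)` and `E(x, y)` be the generating series, by length and final altitude, of the meanders
and of the walks stopped at their first point of negative altitude. A meander followed by one step
is of one of these two kinds, so that `(1 - x Γ(y)) M(x, y) = 1 - E(x, y)`, where `M` has only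
non-negative and `E` only negative powers of `y`.

Write `1 / (1 - x Γ) = W = 1 + A + B`, where `A` collects the negative powers of `y` and `B` has
only non-negative ones, and let `θ = x d/dx`. Applying `θ` to the kernel equation gives
`(1 - x Γ) (θM - M B) = θ(1 - E) + A (1 - E)`. Here the series multiplied by `1 - x Γ` has only
non-negative powers of `y` and the right-hand side only negative ones, and by induction on the power
of `x` this forces both to vanish: `θ(1 - E) = -A (1 - E)`. At `y = 1` this linear differential
equation has the unique solution `exp(-∫ A / x)` with constant term `1`. Finally,
`[y⁰] (y / (1 - y)) f(y)` is the sum of the coefficients of the negative powers in `f`.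
-/

noncomputable section

namespace LatticeWalk

open PowerSeries (C X coeff constantCoeff mk)
open LaurentPolynomial (T)
open AddMonoidAlgebra (single)
open scoped PowerSeries LaurentPolynomial

section PowerSeries

/-- The Euler operator `θ = x d/dx` on formal power series. -/
def eulerDerivation (R : Type*) [CommSemiring R] : Derivation R R⟦X⟧ R⟦X⟧ :=
  (X : R⟦X⟧) • PowerSeries.derivative R

theorem coeff_eulerDerivation {R : Type*} [CommSemiring R] (F : R⟦X⟧) (n : ℕ) :
    coeff n (eulerDerivation R F) = n • coeff n F := by
  change coeff n (X * PowerSeries.derivative R F) = _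
  cases n with
  | zero => simp
  | succ n =>
    rw [PowerSeries.coeff_succ_X_mul, PowerSeries.coeff_derivative, nsmul_eq_mul', Nat.cast_succ]

theorem map_eulerDerivation {R R' : Type*} [CommSemiring R] [CommSemiring R'] (f : R →+* R')
    (F : R⟦X⟧) :
    PowerSeries.map f (eulerDerivation R F) = eulerDerivation R' (PowerSeries.map f F) := by
  ext n
  simp only [PowerSeries.coeff_map, coeff_eulerDerivation, map_nsmul]

variable {R : Type*} [CommRing R]

theorem eulerDerivation_one_sub_X_mul_C (r : R) :
    eulerDerivation R (1 - X * C r) = -(X * C r) := by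
  simp [eulerDerivation, mul_comm]

theorem one_sub_X_mul_C_mul_mk_pow (r : R) : (1 - X * C r) * mk (r ^ ·) = 1 := by
  ext n
  rw [sub_mul, one_mul, mul_assoc, map_sub]
  cases n with
  | zero => simp
  | succ n => simp [PowerSeries.coeff_succ_X_mul, PowerSeries.coeff_one, pow_succ']

theorem eq_zero_of_eulerDerivation_eq_mul [IsAddTorsionFree R] {A F : R⟦X⟧}
    (hA : constantCoeff A = 0) (hF : eulerDerivation R F = A * F) (hF0 : constantCoeff F = 0) :
    F = 0 := by
  ext n
  induction n using Nat.strong_induction_on with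
  | _ n ih =>
    rcases eq_or_ne n 0 with rfl | hn
    · simpa using hF0
    have hzero : n • coeff n F = 0 := by
      rw [← coeff_eulerDerivation, hF, PowerSeries.coeff_mul]
      refine Finset.sum_eq_zero fun ⟨i, j⟩ hij => ?_
      rw [Finset.HasAntidiagonal.mem_antidiagonal] at hij
      rcases eq_or_ne i 0 with rfl | hi
      · simp [hA]
      · simp [ih j (by lia)]
    simpa using (nsmul_eq_zero_iff_right hn).1 hzero

theorem eq_of_eulerDerivation_eq_mul [IsAddTorsionFree R] {A F G : R⟦X⟧}
    (hA : constantCoeff A = 0) (hF : eulerDerivation R F = A * F)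
    (hG : eulerDerivation R G = A * G) (hFG : constantCoeff F = constantCoeff G) : F = G :=
  sub_eq_zero.1 <| eq_zero_of_eulerDerivation_eq_mul hA
    (by rw [map_sub, hF, hG, mul_sub]) (by rw [map_sub, hFG, sub_self])

/-- The power series all of whose coefficients lie in a given non-unital subring. -/
def coeffsIn (P : NonUnitalSubring R) : NonUnitalSubring R⟦X⟧ where
  carrier := {F | ∀ n, coeff n F ∈ P}
  zero_mem' _ := by simp [zero_mem]
  add_mem' hF hG n := by simpa using add_mem (hF n) (hG n)
  neg_mem' hF n := by simpa using neg_mem (hF n)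
  mul_mem' hF hG n := by
    rw [PowerSeries.coeff_mul]
    exact sum_mem fun _ _ => mul_mem (hF _) (hG _)

theorem eulerDerivation_mem_coeffsIn {P : NonUnitalSubring R} {F : R⟦X⟧} (hF : F ∈ coeffsIn P) :
    eulerDerivation R F ∈ coeffsIn P := fun n => by
  rw [coeff_eulerDerivation]
  exact nsmul_mem (hF n) n

theorem eq_zero_of_mem_coeffsIn_of_kernel_mul_mem_coeffsIn {P N : NonUnitalSubring R}
    (hPN : Disjoint P N) {r : R} {F : R⟦X⟧} (hF : F ∈ coeffsIn P)
    (hrF : (1 - X * C r) * F ∈ coeffsIn N) : F = 0 := by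
  ext n
  suffices hN : coeff n F ∈ N by
    simpa using NonUnitalSubring.mem_bot.1 (hPN.le_bot ⟨hF n, hN⟩)
  induction n with
  | zero => simpa [sub_mul, mul_assoc] using hrF 0
  | succ n ih =>
    have hn : coeff n F = 0 := NonUnitalSubring.mem_bot.1 (hPN.le_bot ⟨hF n, ih⟩)
    simpa [sub_mul, mul_assoc, PowerSeries.coeff_succ_X_mul, hn] using hrF (n + 1)

theorem eulerDerivation_eq_mul_of_kernel_factorization {P N : NonUnitalSubring R}
    (hPN : Disjoint P N) {r : R} {F E A B : R⟦X⟧} (hF : F ∈ coeffsIn P) (hE : E ∈ coeffsIn N)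
    (hA : A ∈ coeffsIn N) (hB : B ∈ coeffsIn P) (hFE : (1 - X * C r) * F = 1 - E)
    (hAB : mk (r ^ ·) = 1 + A + B) :
    eulerDerivation R (1 - E) = -A * (1 - E) := by
  have hgeom : (1 - X * C r) * (1 + A + B) = 1 := by
    rw [← hAB, one_sub_X_mul_C_mul_mk_pow]
  have hθ : eulerDerivation R (1 - E) =
      (1 - X * C r) * eulerDerivation R F - X * C r * F := by
    rw [← hFE, Derivation.leibniz, eulerDerivation_one_sub_X_mul_C, smul_eq_mul, smul_eq_mul]
    ring
  have hkernel : (1 - X * C r) * (eulerDerivation R F - F * B) =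
      eulerDerivation R (1 - E) + A * (1 - E) := by
    rw [hθ, ← hFE]
    linear_combination -F * hgeom
  have hN : eulerDerivation R (1 - E) + A * (1 - E) ∈ coeffsIn N := by
    rw [map_sub, Derivation.map_one_eq_zero, zero_sub, mul_sub, mul_one]
    exact add_mem (neg_mem (eulerDerivation_mem_coeffsIn hE)) (sub_mem hA (mul_mem hA hE))
  have hzero : eulerDerivation R F - F * B = 0 :=
    eq_zero_of_mem_coeffsIn_of_kernel_mul_mem_coeffsIn hPN
      (sub_mem (eulerDerivation_mem_coeffsIn hF) (mul_mem hF hB)) (hkernel ▸ hN)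
  rw [hzero, mul_zero] at hkernel
  linear_combination -hkernel

theorem eulerDerivation_integral_divX {F : ℚ⟦X⟧} (hF : constantCoeff F = 0) :
    eulerDerivation ℚ (integral (divX F)) = F := by
  ext n
  rw [coeff_eulerDerivation, integral]
  cases n with
  | zero => simp [hF]
  | succ n =>
    rw [PowerSeries.coeff_succ_X_mul, PowerSeries.coeff_mk, divX, PowerSeries.coeff_mk,
      nsmul_eq_mul, Nat.cast_succ]
    field_simp

theorem constantCoeff_integral (F : ℚ⟦X⟧) : constantCoeff (integral F) = 0 := by
  simp [integral]

theorem eulerDerivation_expOf {F : ℚ⟦X⟧} (hF : constantCoeff F = 0) :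
    eulerDerivation ℚ (expOf F) = eulerDerivation ℚ F * expOf F := by
  simp only [eulerDerivation, Derivation.smul_apply, smul_eq_mul, expOf, PowerSeries.derivative_exp,
    PowerSeries.derivative_subst (PowerSeries.HasSubst.of_constantCoeff_zero' hF)]
  ring

theorem constantCoeff_expOf {F : ℚ⟦X⟧} (hF : constantCoeff F = 0) :
    constantCoeff (expOf F) = 1 := by
  have hsub : expOf F - 1 = (PowerSeries.exp ℚ - 1).subst F := by
    rw [expOf, ← PowerSeries.coe_substAlgHom (PowerSeries.HasSubst.of_constantCoeff_zero' hF),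
      map_sub, map_one]
  have hzero : constantCoeff (expOf F - 1) = 0 := by
    rw [hsub]
    exact PowerSeries.constantCoeff_subst_eq_zero hF _ (by simp)
  simpa [sub_eq_zero] using hzero

theorem eq_expOf_neg_integral_divX {A F : ℚ⟦X⟧} (hA : constantCoeff A = 0)
    (hF : eulerDerivation ℚ F = -A * F) (hF0 : constantCoeff F = 1) :
    F = expOf (-integral (divX A)) := by
  have hint : constantCoeff (-integral (divX A)) = 0 := by
    rw [map_neg, constantCoeff_integral, neg_zero]
  refine eq_of_eulerDerivation_eq_mul (by rw [map_neg, hA, neg_zero]) hF ?_ ?_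
  · rw [eulerDerivation_expOf hint, map_neg, eulerDerivation_integral_divX hA]
  · rw [hF0, constantCoeff_expOf hint]

end PowerSeries

section LaurentPolynomial

/-- The elements of a group algebra supported in an additive subsemigroup. -/
def supportedIn (R : Type*) {G : Type*} [Ring R] [AddSemigroup G] (s : AddSubsemigroup G) :
    NonUnitalSubring (AddMonoidAlgebra R G) where
  __ := (AddMonoidAlgebra.supported R R (s : Set G)).toAddSubgroup
  mul_mem' {f g} hf hg := by
    classical
    refine (Finset.coe_subset.2 (AddMonoidAlgebra.support_coeff_mul_subset f g)).trans ?_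
    rw [Finset.coe_add]
    exact (Set.add_subset_add hf hg).trans (Set.add_subset_iff.2 fun _ ha _ hb => s.add_mem ha hb)

theorem mem_supportedIn {R G : Type*} [Ring R] [AddSemigroup G] {s : AddSubsemigroup G}
    {f : AddMonoidAlgebra R G} : f ∈ supportedIn R s ↔ ∀ g ∉ s, f.coeff g = 0 :=
  AddMonoidAlgebra.mem_supported'

theorem disjoint_supportedIn {R G : Type*} [Ring R] [AddSemigroup G] {s t : AddSubsemigroup G}
    (hst : Disjoint (s : Set G) t) : Disjoint (supportedIn R s) (supportedIn R t) := by
  refine disjoint_iff_inf_le.2 fun f ⟨hs, ht⟩ => NonUnitalSubring.mem_bot.2 ?_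
  ext g
  by_cases hg : g ∈ s
  · simpa using mem_supportedIn.1 ht g (Set.disjoint_left.1 hst hg)
  · simpa using mem_supportedIn.1 hs g hg

theorem T_mem_supportedIn {R : Type*} [Ring R] {s : AddSubsemigroup ℤ} {k : ℤ} (hk : k ∈ s) :
    (T k : R[T;T⁻¹]) ∈ supportedIn R s :=
  mem_supportedIn.2 fun j hj => by
    rw [LaurentPolynomial.T_apply, if_neg (ne_of_mem_of_not_mem hk hj)]

/-- The non-negative integers, as an additive semigroup. -/
def nonnegInt : AddSubsemigroup ℤ := (AddSubmonoid.nonneg ℤ).toAddSubsemigroup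

/-- The negative integers, as an additive semigroup. -/
def negInt : AddSubsemigroup ℤ where
  carrier := Set.Iio 0
  add_mem' ha hb := by
    rw [Set.mem_Iio] at *
    lia

theorem mem_nonnegInt {k : ℤ} : k ∈ nonnegInt ↔ 0 ≤ k := Iff.rfl

theorem mem_negInt {k : ℤ} : k ∈ negInt ↔ k < 0 := Set.mem_Iio

theorem disjoint_nonnegInt_negInt : Disjoint (nonnegInt : Set ℤ) negInt :=
  Set.disjoint_left.2 fun _ hk => mem_negInt.not.2 (mem_nonnegInt.1 hk).not_gt

variable {R : Type*}

/-- The part of a Laurent polynomial formed by the negative powers. -/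
def negPart [Semiring R] : R[T;T⁻¹] →+ R[T;T⁻¹] :=
  (AddMonoidAlgebra.coeffAddEquiv.symm.toAddMonoidHom.comp (Finsupp.filterAddHom (· < 0))).comp
    AddMonoidAlgebra.coeffAddEquiv.toAddMonoidHom

theorem coeff_negPart [Semiring R] (f : R[T;T⁻¹]) (k : ℤ) :
    (negPart f).coeff k = if k < 0 then f.coeff k else 0 :=
  Finsupp.filter_apply _ _ _

theorem negPart_mem_supportedIn [Ring R] (f : R[T;T⁻¹]) : negPart f ∈ supportedIn R negInt :=
  mem_supportedIn.2 fun k hk => by rw [coeff_negPart, if_neg (mt mem_negInt.2 hk)]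

theorem sub_negPart_mem_supportedIn [Ring R] (f : R[T;T⁻¹]) :
    f - negPart f ∈ supportedIn R nonnegInt :=
  mem_supportedIn.2 fun k hk => by
    rw [mem_nonnegInt, not_le] at hk
    simp [coeff_negPart, hk]

theorem negPart_single [Semiring R] (k : ℤ) (a : R) :
    negPart (single k a) = if k < 0 then single k a else 0 := by
  ext j
  rw [coeff_negPart]
  by_cases hjk : k = j
  · subst hjk
    split_ifs <;> simp
  · have hzero : (single k a).coeff j = 0 := by
      rw [AddMonoidAlgebra.coeff_single, Finsupp.single_eq_of_ne (Ne.symm hjk)]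
    split_ifs <;> simp only [hzero, AddMonoidAlgebra.coeff_zero, Finsupp.zero_apply]

/-- Evaluation of Laurent polynomials at `y = 1`. -/
def evalOne (R : Type*) [CommSemiring R] : R[T;T⁻¹] →+* R :=
  LaurentPolynomial.eval₂ (RingHom.id R) 1

theorem evalOne_single [CommSemiring R] (k : ℤ) (a : R) : evalOne R (single k a) = a := by
  simp [evalOne, LaurentPolynomial.single_eq_C_mul_T]

theorem evalOne_T [CommSemiring R] (k : ℤ) : evalOne R (T k) = 1 :=
  evalOne_single k 1

theorem toLaurentSeries_single (k a : ℤ) :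
    toLaurentSeries (single k a) = HahnSeries.single k (a : ℚ) := by
  have hcast : (a : LaurentSeries ℚ) = HahnSeries.single 0 (a : ℚ) := by
    rw [← HahnSeries.C_apply, map_intCast]
  rw [LaurentPolynomial.single_eq_C_mul_T, toLaurentSeries, LaurentPolynomial.eval₂_C_mul_T,
    Units.val_zpow_eq_zpow_val, Units.val_mk0, yVar, ← RatFunc.single_zpow, eq_intCast, hcast,
    HahnSeries.single_mul_single, zero_add, mul_one]

theorem yVar_div_one_sub_yVar :
    yVar / (1 - yVar) = HahnSeries.ofPowerSeries ℤ ℚ (X * mk 1) := by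
  have hgeom : HahnSeries.ofPowerSeries ℤ ℚ (mk 1) * (1 - yVar) = 1 := by
    simpa [yVar, HahnSeries.ofPowerSeries_X] using
      congrArg (HahnSeries.ofPowerSeries ℤ ℚ) (PowerSeries.mk_one_mul_one_sub_eq_one ℚ)
  rw [div_eq_iff (right_ne_zero_of_mul_eq_one hgeom), map_mul, mul_assoc, hgeom, mul_one,
    HahnSeries.ofPowerSeries_X, yVar]

theorem coeff_yVar_div_one_sub_yVar (k : ℤ) :
    (yVar / (1 - yVar)).coeff k = if 0 < k then 1 else 0 := by
  rw [yVar_div_one_sub_yVar, PowerSeries.coeff_coe]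
  rcases lt_trichotomy k 0 with hk | rfl | hk
  · rw [if_pos hk, if_neg hk.not_gt]
  · simp
  · obtain ⟨n, rfl⟩ := Int.eq_succ_of_zero_lt hk
    rw [if_neg hk.not_gt, if_pos hk, show ((n : ℤ) + 1).natAbs = n + 1 by lia,
      PowerSeries.coeff_succ_X_mul, PowerSeries.coeff_mk, Pi.one_apply]

theorem coeff_zero_yVar_div_one_sub_yVar_mul (f : ℤ[T;T⁻¹]) :
    (yVar / (1 - yVar) * toLaurentSeries f).coeff 0 = evalOne ℤ (negPart f) := by
  induction f using AddMonoidAlgebra.induction_linear with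
  | zero => simp
  | add f g hf hg => simp [mul_add, hf, hg]
  | single k a =>
    rw [toLaurentSeries_single, ← neg_add_cancel k, HahnSeries.coeff_mul_single_add,
      coeff_yVar_div_one_sub_yVar, negPart_single]
    rcases lt_or_ge k 0 with hk | hk
    · rw [if_pos (by lia), if_pos hk, one_mul, evalOne_single]
    · rw [if_neg (by lia), if_neg (by lia), zero_mul, map_zero, Int.cast_zero]

end LaurentPolynomial

section Walks

/-- The walk `A` followed by the step `(1, u)`. -/
def appendStep {n : ℕ} (A : Fin (n + 1) → ℤ × ℤ) (u : ℤ) : Fin (n + 2) → ℤ × ℤ :=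
  Fin.snoc A (A (Fin.last n) + (1, u))

variable {n : ℕ}

theorem appendStep_castSucc (A : Fin (n + 1) → ℤ × ℤ) (u : ℤ) (k : Fin (n + 1)) :
    appendStep A u k.castSucc = A k :=
  Fin.snoc_castSucc (α := fun _ => ℤ × ℤ) _ _ _

theorem appendStep_last (A : Fin (n + 1) → ℤ × ℤ) (u : ℤ) :
    appendStep A u (Fin.last (n + 1)) = A (Fin.last n) + (1, u) :=
  Fin.snoc_last (α := fun _ => ℤ × ℤ) _ _

theorem finalAltitude_appendStep (A : Fin (n + 1) → ℤ × ℤ) (u : ℤ) :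
    finalAltitude (appendStep A u) = finalAltitude A + u :=
  congrArg Prod.snd (appendStep_last A u)

theorem appendStep_injective2 : Function.Injective2 (appendStep (n := n)) := by
  intro A B u v h
  obtain ⟨rfl, hlast⟩ := Fin.snoc_injective2 (α := fun _ => ℤ × ℤ) h
  simpa using hlast

theorem appendStep_mem_walks {S : Finset ℤ} {A : Fin (n + 1) → ℤ × ℤ} {u : ℤ} :
    appendStep A u ∈ walks S (n + 1) ↔ A ∈ walks S n ∧ u ∈ S := by
  have hzero : appendStep A u 0 = A 0 := appendStep_castSucc A u 0
  simp [walks, Fin.forall_fin_succ' (n := n), hzero, ← Fin.castSucc_succ, appendStep_castSucc,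
    appendStep_last, and_assoc]

theorem exists_appendStep_eq {S : Finset ℤ} {B : Fin (n + 2) → ℤ × ℤ} (hB : B ∈ walks S (n + 1)) :
    ∃ A u, appendStep A u = B := by
  obtain ⟨u, -, hu⟩ := hB.2 (Fin.last n)
  refine ⟨Fin.init B, u, ?_⟩
  conv_rhs => rw [← Fin.snoc_init_self B]
  rw [appendStep, ← hu]
  simp [Fin.init]

theorem image2_appendStep_walks (S : Finset ℤ) (n : ℕ) :
    Set.image2 appendStep (walks S n) S = walks S (n + 1) := by
  ext B
  constructor
  · rintro ⟨A, hA, u, hu, rfl⟩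
    exact appendStep_mem_walks.2 ⟨hA, hu⟩
  · intro hB
    obtain ⟨A, u, rfl⟩ := exists_appendStep_eq hB
    obtain ⟨hA, hu⟩ := appendStep_mem_walks.1 hB
    exact Set.mem_image2_of_mem hA hu

/-- The walks of length `n` whose final point is the only one of negative altitude. -/
def exits (S : Finset ℤ) (n : ℕ) : Set (Fin (n + 1) → ℤ × ℤ) :=
  {A | A ∈ walks S n ∧ ∀ k, (A k).2 < 0 ↔ k = Fin.last n}

theorem appendStep_mem_meanders {S : Finset ℤ} {A : Fin (n + 1) → ℤ × ℤ} {u : ℤ} :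
    appendStep A u ∈ meanders S (n + 1) ↔
      (A ∈ meanders S n ∧ u ∈ S) ∧ 0 ≤ finalAltitude A + u := by
  simp only [meanders, Set.mem_ofPred_eq, appendStep_mem_walks, Fin.forall_fin_succ' (n := n + 1),
    appendStep_castSucc, appendStep_last, finalAltitude, Prod.snd_add]
  tauto

theorem appendStep_mem_exits {S : Finset ℤ} {A : Fin (n + 1) → ℤ × ℤ} {u : ℤ} :
    appendStep A u ∈ exits S (n + 1) ↔
      (A ∈ meanders S n ∧ u ∈ S) ∧ finalAltitude A + u < 0 := by
  simp only [exits, meanders, Set.mem_ofPred_eq, appendStep_mem_walks,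
    Fin.forall_fin_succ' (n := n + 1), appendStep_castSucc, appendStep_last, finalAltitude,
    Prod.snd_add, Fin.castSucc_ne_last, iff_false, iff_true, not_lt]
  tauto

theorem image2_appendStep_meanders (S : Finset ℤ) (n : ℕ) :
    Set.image2 appendStep (meanders S n) S = meanders S (n + 1) ∪ exits S (n + 1) := by
  ext B
  constructor
  · rintro ⟨A, hA, u, hu, rfl⟩
    rcases le_or_gt 0 (finalAltitude A + u) with h | h
    · exact Or.inl (appendStep_mem_meanders.2 ⟨⟨hA, hu⟩, h⟩)
    · exact Or.inr (appendStep_mem_exits.2 ⟨⟨hA, hu⟩, h⟩)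
  · rintro (hB | hB) <;> obtain ⟨A, u, rfl⟩ := exists_appendStep_eq hB.1
    · exact Set.mem_image2_of_mem (appendStep_mem_meanders.1 hB).1.1
        (appendStep_mem_meanders.1 hB).1.2
    · exact Set.mem_image2_of_mem (appendStep_mem_exits.1 hB).1.1 (appendStep_mem_exits.1 hB).1.2

theorem finalAltitude_nonneg_of_mem_meanders {S : Finset ℤ} {A : Fin (n + 1) → ℤ × ℤ}
    (hA : A ∈ meanders S n) : 0 ≤ finalAltitude A :=
  hA.2 (Fin.last n)

theorem finalAltitude_neg_of_mem_exits {S : Finset ℤ} {A : Fin (n + 1) → ℤ × ℤ}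
    (hA : A ∈ exits S n) : finalAltitude A < 0 :=
  (hA.2 (Fin.last n)).2 rfl

theorem disjoint_meanders_exits (S : Finset ℤ) (n : ℕ) : Disjoint (meanders S n) (exits S n) :=
  Set.disjoint_left.2 fun _ hM hE =>
    (finalAltitude_nonneg_of_mem_meanders hM).not_gt (finalAltitude_neg_of_mem_exits hE)

theorem meanders_finite (S : Finset ℤ) (n : ℕ) : (meanders S n).Finite :=
  (walks_finite S n).subset fun _ h => h.1

theorem exits_finite (S : Finset ℤ) (n : ℕ) : (exits S n).Finite :=
  (walks_finite S n).subset fun _ h => h.1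

theorem walks_zero (S : Finset ℤ) : walks S 0 = {0} := by
  ext A
  simp [walks, funext_iff, Prod.ext_iff, Fin.forall_fin_one]

theorem meanders_zero (S : Finset ℤ) : meanders S 0 = {0} := by
  ext A
  simp +contextual [meanders, walks_zero]

theorem exits_zero (S : Finset ℤ) : exits S 0 = ∅ := by
  ext A
  simp +contextual [exits, walks_zero]

/-- The generating Laurent polynomial `∑ yᵏ` of a set of walks, where `k` is the final altitude.
The set is meant to be finite: otherwise the sum takes the value `0`. -/
def altitudePoly (s : Set (Fin (n + 1) → ℤ × ℤ)) : ℤ[T;T⁻¹] := ∑ᶠ A ∈ s, T (finalAltitude A)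

theorem coeff_altitudePoly {s : Set (Fin (n + 1) → ℤ × ℤ)} (hs : s.Finite) (k : ℤ) :
    (altitudePoly s).coeff k = {A | A ∈ s ∧ finalAltitude A = k}.ncard := by
  classical
  lift s to Finset (Fin (n + 1) → ℤ × ℤ) using hs
  have hfilter : {A | A ∈ (s : Set (Fin (n + 1) → ℤ × ℤ)) ∧ finalAltitude A = k} =
      s.filter (finalAltitude · = k) := by
    ext A
    simp
  rw [hfilter, Set.ncard_coe_finset, altitudePoly, finsum_mem_coe_finset,
    AddMonoidAlgebra.coeff_sum, Finset.sum_apply']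
  simp

theorem evalOne_altitudePoly {s : Set (Fin (n + 1) → ℤ × ℤ)} (hs : s.Finite) :
    evalOne ℤ (altitudePoly s) = s.ncard := by
  lift s to Finset (Fin (n + 1) → ℤ × ℤ) using hs
  rw [altitudePoly, finsum_mem_coe_finset, map_sum]
  simp [evalOne_T]

theorem altitudePoly_mem_supportedIn {s : Set (Fin (n + 1) → ℤ × ℤ)} {t : AddSubsemigroup ℤ}
    (hst : ∀ A ∈ s, finalAltitude A ∈ t) : altitudePoly s ∈ supportedIn ℤ t :=
  finsum_mem_induction (· ∈ supportedIn ℤ t) (zero_mem _) (fun _ _ => add_mem)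
    fun A hA => T_mem_supportedIn (hst A hA)

theorem altitudePoly_image2_appendStep (S : Finset ℤ) {s : Set (Fin (n + 1) → ℤ × ℤ)}
    (hs : s.Finite) :
    altitudePoly (Set.image2 appendStep s S) = Gam S * altitudePoly s := by
  lift s to Finset (Fin (n + 1) → ℤ × ℤ) using hs
  rw [← Set.image_uncurry_prod, altitudePoly,
    finsum_mem_image appendStep_injective2.uncurry.injOn, ← Finset.coe_product,
    finsum_mem_coe_finset, Finset.sum_product_right, Gam, altitudePoly, finsum_mem_coe_finset,
    Finset.sum_mul_sum]
  simp only [Function.uncurry_apply_pair, finalAltitude_appendStep, LaurentPolynomial.T_add,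
    mul_comm]

theorem altitudePoly_walks (S : Finset ℤ) (n : ℕ) : altitudePoly (walks S n) = Gam S ^ n := by
  induction n with
  | zero => simp [walks_zero, altitudePoly, finalAltitude]
  | succ n ih =>
    rw [← image2_appendStep_walks, altitudePoly_image2_appendStep S (walks_finite S n), ih,
      pow_succ']

theorem altitudePoly_meanders_zero (S : Finset ℤ) : altitudePoly (meanders S 0) = 1 := by
  simp [meanders_zero, altitudePoly, finalAltitude]

theorem altitudePoly_exits_zero (S : Finset ℤ) : altitudePoly (exits S 0) = 0 := by
  rw [exits_zero, altitudePoly, finsum_mem_empty]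

theorem altitudePoly_meanders_succ (S : Finset ℤ) (n : ℕ) :
    altitudePoly (meanders S (n + 1)) + altitudePoly (exits S (n + 1)) =
      Gam S * altitudePoly (meanders S n) := by
  rw [← altitudePoly_image2_appendStep S (meanders_finite S n), image2_appendStep_meanders]
  exact (finsum_mem_union (disjoint_meanders_exits S _) (meanders_finite S _)
    (exits_finite S _)).symm

end Walks

section GeneratingSeries

variable (S : Finset ℤ)

theorem W_eq_mk_Gam_pow : W S = mk (Gam S ^ ·) := by
  ext n k
  rw [PowerSeries.coeff_mk, ← altitudePoly_walks, coeff_altitudePoly (walks_finite S n), W,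
    PowerSeries.coeff_mk]
  rfl

theorem coeff_A (n : ℕ) : coeff n (A S) = evalOne ℤ (negPart (Gam S ^ n)) := by
  rw [A, PowerSeries.coeff_mk, yOverOneSubYMulW, PowerSeries.coeff_C_mul, PowerSeries.coeff_map,
    W_eq_mk_Gam_pow, PowerSeries.coeff_mk, coeff_zero_yVar_div_one_sub_yVar_mul]

theorem constantCoeff_A : constantCoeff (A S) = 0 := by
  rw [← PowerSeries.coeff_zero_eq_constantCoeff_apply, coeff_A, pow_zero,
    AddMonoidAlgebra.one_def, negPart_single]
  simp

/-- The generating series of meanders, by length and final altitude. -/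
def meanderSeries : ℤ[T;T⁻¹]⟦X⟧ := mk fun n => altitudePoly (meanders S n)

/-- The generating series of the walks ending at their first point of negative altitude, by length
and final altitude. -/
def exitSeries : ℤ[T;T⁻¹]⟦X⟧ := mk fun n => altitudePoly (exits S n)

/-- The part of `1 / (1 - x Γ(y))` formed by the negative powers of `y`. -/
def negPartSeries : ℤ[T;T⁻¹]⟦X⟧ := mk fun n => negPart (Gam S ^ n)

theorem meanderSeries_mem_coeffsIn : meanderSeries S ∈ coeffsIn (supportedIn ℤ nonnegInt) :=
  fun n => by
    rw [meanderSeries, PowerSeries.coeff_mk]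
    exact altitudePoly_mem_supportedIn fun _ => finalAltitude_nonneg_of_mem_meanders

theorem exitSeries_mem_coeffsIn : exitSeries S ∈ coeffsIn (supportedIn ℤ negInt) := fun n => by
  rw [exitSeries, PowerSeries.coeff_mk]
  exact altitudePoly_mem_supportedIn fun _ hA =>
    mem_negInt.2 (finalAltitude_neg_of_mem_exits hA)

theorem negPartSeries_mem_coeffsIn : negPartSeries S ∈ coeffsIn (supportedIn ℤ negInt) :=
  fun n => by
    rw [negPartSeries, PowerSeries.coeff_mk]
    exact negPart_mem_supportedIn _

theorem mk_Gam_pow_sub_one_sub_negPartSeries_mem_coeffsIn :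
    mk (Gam S ^ ·) - 1 - negPartSeries S ∈ coeffsIn (supportedIn ℤ nonnegInt) := by
  have hone : (1 : ℤ[T;T⁻¹]⟦X⟧) ∈ coeffsIn (supportedIn ℤ nonnegInt) := fun n => by
    rw [PowerSeries.coeff_one]
    split_ifs
    · exact T_mem_supportedIn (mem_nonnegInt.2 le_rfl)
    · exact zero_mem _
  rw [sub_right_comm]
  refine sub_mem (fun n => ?_) hone
  simpa [negPartSeries] using sub_negPart_mem_supportedIn (Gam S ^ n)

theorem kernel_mul_meanderSeries :
    (1 - X * C (Gam S)) * meanderSeries S = 1 - exitSeries S := by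
  ext1 n
  rw [sub_mul, one_mul, mul_assoc, map_sub, map_sub]
  cases n with
  | zero =>
    simp [meanderSeries, exitSeries, altitudePoly_meanders_zero, altitudePoly_exits_zero]
  | succ n =>
    simp [PowerSeries.coeff_succ_X_mul, PowerSeries.coeff_one, meanderSeries, exitSeries,
      ← altitudePoly_meanders_succ]

theorem eulerDerivation_one_sub_exitSeries :
    eulerDerivation _ (1 - exitSeries S) = -negPartSeries S * (1 - exitSeries S) :=
  eulerDerivation_eq_mul_of_kernel_factorization (disjoint_supportedIn disjoint_nonnegInt_negInt)
    (meanderSeries_mem_coeffsIn S) (exitSeries_mem_coeffsIn S) (negPartSeries_mem_coeffsIn S)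
    (mk_Gam_pow_sub_one_sub_negPartSeries_mem_coeffsIn S) (kernel_mul_meanderSeries S) (by ring)

/-- Evaluation at `y = 1` of power series over Laurent polynomials, with rational coefficients. -/
def evalOneSeries : ℤ[T;T⁻¹]⟦X⟧ →+* ℚ⟦X⟧ :=
  PowerSeries.map ((Int.castRingHom ℚ).comp (evalOne ℤ))

theorem coeff_evalOneSeries (F : ℤ[T;T⁻¹]⟦X⟧) (n : ℕ) :
    coeff n (evalOneSeries F) = evalOne ℤ (coeff n F) := by
  simp [evalOneSeries]

theorem evalOneSeries_meanderSeries :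
    evalOneSeries (meanderSeries S) = PowerSeries.map (Int.castRingHom ℚ) (M S) := by
  ext n
  simp [coeff_evalOneSeries, meanderSeries, M, evalOne_altitudePoly (meanders_finite S n)]

theorem evalOneSeries_negPartSeries : evalOneSeries (negPartSeries S) = A S := by
  ext n
  rw [coeff_evalOneSeries, negPartSeries, PowerSeries.coeff_mk, coeff_A]

theorem evalOneSeries_kernel :
    evalOneSeries (1 - X * C (Gam S)) = 1 - X * C (GamOne S : ℚ) := by
  simp [evalOneSeries, evalOne, GamOne]

theorem constantCoeff_evalOneSeries_one_sub_exitSeries :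
    constantCoeff (evalOneSeries (1 - exitSeries S)) = 1 := by
  rw [← PowerSeries.coeff_zero_eq_constantCoeff_apply, coeff_evalOneSeries]
  simp [exitSeries, altitudePoly_exits_zero]

theorem evalOneSeries_one_sub_exitSeries :
    evalOneSeries (1 - exitSeries S) = expOf (-integral (divX (A S))) := by
  refine eq_expOf_neg_integral_divX (constantCoeff_A S) ?_
    (constantCoeff_evalOneSeries_one_sub_exitSeries S)
  rw [evalOneSeries, ← map_eulerDerivation, ← evalOneSeries, eulerDerivation_one_sub_exitSeries,
    map_mul, map_neg, evalOneSeries_negPartSeries]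

theorem kernel_mul_map_M :
    (1 - X * C (GamOne S : ℚ)) * PowerSeries.map (Int.castRingHom ℚ) (M S) =
      expOf (-integral (divX (A S))) := by
  rw [← evalOneSeries_kernel, ← evalOneSeries_meanderSeries, ← map_mul, kernel_mul_meanderSeries,
    evalOneSeries_one_sub_exitSeries]

end GeneratingSeries

end LatticeWalk

end

theorem mainTheorem6 (S : Finset ℤ) :
    PowerSeries.constantCoeff (LatticeWalk.A S) = 0 ∧
      PowerSeries.map (Int.castRingHom ℚ) (LatticeWalk.M S) =
        LatticeWalk.expOf (-LatticeWalk.integral (LatticeWalk.divX (LatticeWalk.A S))) *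
          (1 - PowerSeries.X * PowerSeries.C (LatticeWalk.GamOne S : ℚ))⁻¹ := by
  refine ⟨LatticeWalk.constantCoeff_A S, ?_⟩
  rw [PowerSeries.eq_mul_inv_iff_mul_eq (by simp), mul_comm, LatticeWalk.kernel_mul_map_M]
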